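/- Let $\mathbb{R}_{\max}=\mathbb{R}\cup\{-\infty\}$, let $n\ge 1$, and let $A,B\in\mathbb{R}_{\max}^{m\times n}$ have no common column identically equal to $-\infty$ (for every $j$ there is $i$ with $a_{ij}\ne-\infty$ or $b_{ij}\neq-\infty$). Write $Ax$ for the max-plus product, $(Ax)_i=\max_j(a_{ij}+x_j)$, and put $(A^\sharp y)_j=\min_i(-a_{ij}+y_i)\in\mathbb{R}\cup\{\pm\infty\}$ with the convention $(-\infty)+(+\infty)=+\infty$. For a max-plus matrix $M$ with $k$ rows let $\operatorname{span}(M)$ be its max-plus column span and, for $z\in\mathbb{R}_{\max}^k$, let $P_Mz=\sup\{y\in\operatorname{span}(M)\mid y\le z\}$. Let $C=\begin{pmatrix}A\\B\end{pmatrix}$ and $D=\begin{pmatrix}I\\I\end{pmatrix}$, where $I$ is the $m\times m$ max-plus identity matrix ($0$ on the diagonal, $-\infty$ elsewhere), and for $x\in\mathbb{R}_{\max}^n$ let $$f(x)=x\wedge A^\sharp Bx\wedge B^\sharp Ax,\qquad g(x)=A^\sharp Ax\wedge B^\sharp Bx\wedge A^\sharp Bx\wedge B^\sharp Ax,\qquad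 h(x)=A^\sharp Bx\wedge B^\sharp Ax ,$$ where $\wedge$ is the componentwise minimum. For a map $q:\mathbb{R}_{\max}^k\to\mathbb{R}_{\max}^k$ let $r(q)$ denote its largest eigenvalue, $r(q)=\max\{\lambda\in\mathbb{R}_{\max}\mid \exists x\in\mathbb{R}_{\max}^k,\ x\not\equiv-\infty,\ q(x)=\lambda+x\}$. For $u,v\in\mathbb{R}_{\max}^m$ let $d_\infty(u,v)=\max|u_i-v_i|$ over all $i$ with $v_i\ne-\infty$ if $u$ and $v$ have the same set of finite coordinates, and $d_\infty(u,v)=+\infty$ otherwise. Then the maxima and the minimum below exist, and $$r(P_CP_D)=r(P_DP_C)=r(f)=r(g)=r(h)=-\min_{x\in\mathbb{R}_{\max}^n,\ x\not\equiv-\infty} d_\infty(Ax,Bx),$$ where the common value is $-\infty$ if $d_\infty(Ax,Bx)=+\infty$ for all $x\not\equiv-\infty$. -/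

import Mathlib

open scoped ENNReal

noncomputable section

namespace MaxPlus

/-- The max-plus semiring `ℝ ∪ {-∞}`: the sum is `max` (written `⊔`), the product is `+`,
with `-∞ = ⊥` absorbing for `+`. -/
abbrev Rmax : Type := WithBot ℝ

/-- The inclusion of `ℝ ∪ {-∞}` in `ℝ ∪ {-∞, +∞}`. -/
def ext (a : Rmax) : EReal := WithBot.recBotCoe (⊥ : EReal) (fun t : ℝ => (t : EReal)) a

variable {ι κ : Type} [Fintype ι] [Fintype κ]

/-- The max-plus matrix-vector product `(A x)_i = max_j (a_ij + x_j)`. -/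
def mulVec (A : Matrix ι κ Rmax) (x : κ → Rmax) : ι → Rmax :=
  fun i => Finset.univ.sup fun j => A i j + x j

/-- The max-plus identity matrix: `0` on the diagonal, `-∞` elsewhere. -/
def idMatrix (ι : Type) [DecidableEq ι] : Matrix ι ι Rmax :=
  fun i j => if i = j then 0 else ⊥

/-- The max-plus column span of `A`. -/
def span (A : Matrix ι κ Rmax) : Set (ι → Rmax) :=
  {v | ∃ c : κ → Rmax, v = mulVec A c}

/-- The nonlinear projector `P_A z = sup {y ∈ span A | y ≤ z}`
(the set contains `-∞` and is bounded above by `z`). -/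
def proj (A : Matrix ι κ Rmax) (z : ι → Rmax) : ι → Rmax :=
  sSup {y | y ∈ span A ∧ y ≤ z}

/-- `-a + y` in `ℝ ∪ {-∞, +∞}`, with the convention `(-∞) + (+∞) = +∞`. -/
def resid (a y : Rmax) : EReal :=
  if a = ⊥ then ⊤ else ext y - ext a

/-- The residuated operator `(A♯ y)_j = min_i (-a_ij + y_i)`. -/
def sharp (A : Matrix ι κ Rmax) (y : ι → Rmax) : κ → EReal :=
  fun j => Finset.univ.inf fun i => resid (A i j) (y i)

/-- `f(x) = x ∧ A♯ B x ∧ B♯ A x`. -/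
def funF (A B : Matrix ι κ Rmax) (x : κ → Rmax) : κ → EReal :=
  (fun j => ext (x j)) ⊓ sharp A (mulVec B x) ⊓ sharp B (mulVec A x)

/-- `g(x) = A♯ A x ∧ B♯ B x ∧ A♯ B x ∧ B♯ A x`. -/
def funG (A B : Matrix ι κ Rmax) (x : κ → Rmax) : κ → EReal :=
  sharp A (mulVec A x) ⊓ sharp B (mulVec B x) ⊓ sharp A (mulVec B x) ⊓ sharp B (mulVec A x)

/-- `h(x) = A♯ B x ∧ B♯ A x`. -/
def funH (A B : Matrix ι κ Rmax) (x : κ → Rmax) : κ → EReal :=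
  sharp A (mulVec B x) ⊓ sharp B (mulVec A x)

/-- A map of `(ℝ ∪ {-∞})^ι` to itself, seen as taking values in `(ℝ ∪ {-∞, +∞})^ι`. -/
def extMap (F : (ι → Rmax) → ι → Rmax) (x : ι → Rmax) : ι → EReal :=
  fun i => ext (F x i)

/-- The eigenvalues `t ∈ ℝ ∪ {-∞}` of a map `F` on `(ℝ ∪ {-∞})^ι`: those with `F(x) = t + x`
for some `x` that is not identically `-∞`. -/
def eigenvalues (F : (ι → Rmax) → ι → EReal) : Set Rmax :=
  {t | ∃ x : ι → Rmax, x ≠ ⊥ ∧ ∀ i, F x i = ext (t + x i)}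

/-- `r` is the spectral radius of `F`, its largest eigenvalue. -/
def IsSpectralRadius (F : (ι → Rmax) → ι → EReal) (r : Rmax) : Prop :=
  IsGreatest (eigenvalues F) r

/-- The support of a vector. -/
def supp (u : ι → Rmax) : Set ι := {i | u i ≠ ⊥}

open Classical in
/-- The Chebyshev distance: `max |u_i - v_i|` over the common support of `u` and `v`,
and `+∞` if the supports differ. -/
def chebDist (u v : ι → Rmax) : ℝ≥0∞ :=
  if supp u = supp v then
    ⨆ i ∈ supp v, ENNReal.ofReal |(u i).unbotD 0 - (v i).unbotD 0|
  else ⊤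

end MaxPlus

end

open scoped ENNReal NNReal
open Filter Topology

/-! All five maps are monotone, commute with adding scalars, and are continuous once `ℝ ∪ {-∞}` is
identified with `ℝ≥0` by the exponential. For such a map nonlinear Perron-Frobenius theory
(`exists_isGreatest_eigenvalue`) says that the largest eigenvalue exists and equals the largest `t`
with `t + x ≤ q x` for some `x ≠ -∞`. So only these sets of sub-eigenvalues have to be compared, and
inequalities are easier than eigenvector equations.

Each set equals `gapScalars A B`. For `h` this is residuation: `t + x ≤ C♯(Bx, Ax)` iff `t + Ax ≤
Bx` and `t + Bx ≤ Ax`. These two inequalities force `t ≤ 0` because `Cx` has a finite entry, so the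
extra terms in `f` and `g` change nothing. For `P_C P_D` the link is that `span D` is the diagonal;
exchanging the factors preserves the set. Finally, for real `s ≥ 0`, `-s` satisfies the inequalities
at `x` iff `d_∞(Ax, Bx) ≤ s`, so the greatest gap scalar is minus the least distance. -/

namespace MaxPlus

/-! ### Nonlinear Perron-Frobenius theory on the nonnegative cone. -/

section

instance {ι : Type} : ContinuousSup (ι → ℝ≥0) :=
  ⟨continuous_pi fun i =>
    ((continuous_apply i).comp continuous_fst).max ((continuous_apply i).comp continuous_snd)⟩

/-- A monotone continuous map with a bounded increasing orbit has a fixed point above its start. -/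
theorem exists_fixedPoint_of_le {ι : Type} {F : (ι → ℝ≥0) → ι → ℝ≥0}
    (mono : Monotone F) (cont : Continuous F) {u v : ι → ℝ≥0} (hu : u ≤ F u)
    (hv : ∀ k, F^[k] u ≤ v) : ∃ x, u ≤ x ∧ F x = x := by
  have hm : Monotone fun k => F^[k] u := mono.monotone_iterate_of_le_map hu
  have ht : Tendsto (fun k => F^[k] u) atTop (𝓝 fun i => ⨆ k, F^[k] u i) := by
    rw [tendsto_pi_nhds]
    intro i
    refine tendsto_atTop_ciSup (fun a b hab => hm hab i) ⟨v i, ?_⟩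
    rintro _ ⟨k, rfl⟩
    exact hv k i
  exact ⟨_, hm.ge_of_tendsto ht 0, isFixedPt_of_tendsto_iterate ht cont.continuousAt⟩

/-- The nonnegative vectors whose largest coordinate is `1`. -/
def unitMax (ι : Type) : Set (ι → ℝ≥0) := {x | x ≤ 1 ∧ ∃ i, x i = 1}

theorem isCompact_unitMax (ι : Type) [Fintype ι] : IsCompact (unitMax ι) := by
  refine (isCompact_Icc (a := (0 : ι → ℝ≥0)) (b := 1)).of_isClosed_subset ?_
    fun x hx => ⟨zero_le, hx.1⟩
  have : unitMax ι = {x | x ≤ 1} ∩ ⋃ i, {x : ι → ℝ≥0 | x i = 1} := by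
    ext x; simp [unitMax]
  rw [this]
  exact isClosed_Iic.inter
    (isClosed_iUnion_of_finite fun i => isClosed_eq (continuous_apply i) continuous_const)

theorem ne_zero_of_mem_unitMax {ι : Type} {x : ι → ℝ≥0} (hx : x ∈ unitMax ι) : x ≠ 0 := by
  rintro rfl
  obtain ⟨i, hi⟩ := hx.2
  simp at hi

theorem exists_smul_mem_unitMax {ι : Type} [Fintype ι] [Nonempty ι] {x : ι → ℝ≥0}
    (hx : x ≠ 0) : ∃ M : ℝ≥0, 0 < M ∧ (∀ i, x i ≤ M) ∧ M⁻¹ • x ∈ unitMax ι := by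
  obtain ⟨i, hi⟩ := Finite.exists_max x
  have hpos : 0 < x i := by
    by_contra h
    apply hx
    funext j
    have := hi j
    simp_all
  refine ⟨x i, hpos, hi, fun j => ?_, i, ?_⟩
  · simpa using inv_mul_le_one_of_le₀ (hi j) zero_le
  · simp [hpos.ne']

variable {ι : Type} [Fintype ι] [Nonempty ι] {q : (ι → ℝ≥0) → ι → ℝ≥0}

theorem exists_isGreatest_subeigenvalue (mono : Monotone q)
    (hom : ∀ (c : ℝ≥0) x, q (c • x) = c • q x) (cont : Continuous q) :
    ∃ r, IsGreatest {t : ℝ≥0 | ∃ x, x ≠ 0 ∧ t • x ≤ q x} r := by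
  obtain ⟨M, hM⟩ : ∃ M : ℝ≥0, ∀ i, q 1 i ≤ M := by
    obtain ⟨i, hi⟩ := Finite.exists_max (q 1)
    exact ⟨_, hi⟩
  -- By homogeneity `x` may be normalized to maximum `1`; then `q x ≤ q 1 ≤ M` bounds `t` at the
  -- coordinate where `x i = 1`.
  set Z : Set (ℝ≥0 × (ι → ℝ≥0)) := (Set.Icc 0 M ×ˢ unitMax ι) ∩ {p | p.1 • p.2 ≤ q p.2}
  have hZ : IsCompact Z := by
    refine (isCompact_Icc.prod (isCompact_unitMax ι)).inter_right (isClosed_le ?_ ?_)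
    · exact continuous_fst.smul continuous_snd
    · exact cont.comp continuous_snd
  have key : {t : ℝ≥0 | ∃ x, x ≠ 0 ∧ t • x ≤ q x} = Prod.fst '' Z := by
    ext t
    constructor
    · rintro ⟨x, hx, h⟩
      obtain ⟨N, hN, -, hy⟩ := exists_smul_mem_unitMax hx
      have h2 : t • (N⁻¹ • x) ≤ q (N⁻¹ • x) := by
        rw [hom, smul_comm]
        exact fun i => mul_le_mul_right (h i) _
      refine ⟨(t, N⁻¹ • x), ⟨⟨⟨zero_le, ?_⟩, hy⟩, h2⟩, rfl⟩
      obtain ⟨i, hi⟩ := hy.2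
      have h3 := h2 i
      rw [Pi.smul_apply, hi] at h3
      simpa using (h3.trans (mono hy.1 i)).trans (hM i)
    · rintro ⟨⟨t, x⟩, ⟨⟨-, hx⟩, h⟩, rfl⟩
      exact ⟨x, ne_zero_of_mem_unitMax hx, h⟩
  rw [key]
  refine (hZ.image continuous_fst).exists_isGreatest ?_
  rw [← key]
  exact ⟨0, 1, one_ne_zero, by simp⟩

/-- The solution is the limit of the increasing orbit of `1`. If the orbit were unbounded,
normalizing it would make the constant `1` vanish in the limit and leave a nonzero `z` with `t • z ≤
q z`. -/
theorem exists_resolvent (mono : Monotone q)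
    (hom : ∀ (c : ℝ≥0) x, q (c • x) = c • q x) (cont : Continuous q) {t : ℝ≥0} (ht : 0 < t)
    (hq : ∀ x, t • x ≤ q x → x = 0) : ∃ x, 1 ≤ x ∧ 1 ⊔ t⁻¹ • q x = x := by
  set F : (ι → ℝ≥0) → ι → ℝ≥0 := fun x => 1 ⊔ t⁻¹ • q x with hF
  have hFm : Monotone F := fun x y h =>
    sup_le_sup_left (fun i => mul_le_mul_right (mono h i) _) _
  have hFc : Continuous F := continuous_const.sup (cont.fun_const_smul t⁻¹)
  have h1 : (1 : ι → ℝ≥0) ≤ F 1 := le_sup_left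
  have hit : Monotone fun k => F^[k] 1 := hFm.monotone_iterate_of_le_map h1
  by_cases hb : ∃ N : ℕ, ∀ k, F^[k] 1 ≤ fun _ => (N : ℝ≥0)
  · obtain ⟨N, hN⟩ := hb
    exact exists_fixedPoint_of_le hFm hFc h1 hN
  exfalso
  push Not at hb
  -- Take an orbit point `w ≤ F w` whose maximum `M` exceeds `N + 1`, and divide by `M`.
  have hy : ∀ N : ℕ, ∃ y ∈ unitMax ι, t • y ≤ (fun _ => t * (N + 1 : ℝ≥0)⁻¹) ⊔ q y := by
    intro N
    obtain ⟨k, hk⟩ := hb (N + 1)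
    set w := F^[k] 1
    have hw : w ≤ F w := by
      have := hit (Nat.le_succ k)
      simpa only [Function.iterate_succ_apply'] using this
    have hw1 : (1 : ι → ℝ≥0) ≤ w := hit (Nat.zero_le k)
    have hw0 : w ≠ 0 := fun h => by
      have := hw1 (Classical.arbitrary ι)
      simp [h] at this
    obtain ⟨M, hM, hwM, hmem⟩ := exists_smul_mem_unitMax hw0
    have hNM : (N + 1 : ℝ≥0) ≤ M := by
      obtain ⟨i, hi⟩ := not_forall.mp hk
      have := (not_le.mp hi).le.trans (hwM i)
      exact_mod_cast this
    refine ⟨_, hmem, fun i => ?_⟩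
    have := hw i
    simp only [hF, Pi.sup_apply, Pi.smul_apply, smul_eq_mul, Pi.one_apply, le_sup_iff, hom] at this ⊢
    rcases this with h | h
    · left
      gcongr
      calc M⁻¹ * w i ≤ M⁻¹ * 1 := by gcongr
        _ ≤ _ := by rw [mul_one]; gcongr
    · right
      calc t * (M⁻¹ * w i) ≤ t * (M⁻¹ * (t⁻¹ * q w i)) := by gcongr
        _ = M⁻¹ * q w i := by field_simp
  choose y hyK hy using hy
  obtain ⟨z, hz, φ, hφ, hlim⟩ := (isCompact_unitMax ι).tendsto_subseq hyK
  refine ne_zero_of_mem_unitMax hz (hq z ?_)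
  have h0 : Tendsto (fun N : ℕ => t * (N + 1 : ℝ≥0)⁻¹) atTop (𝓝 0) := by
    have : Tendsto (fun N : ℕ => (1 : ℝ≥0) / (N + 1)) atTop (𝓝 0) :=
      tendsto_one_div_add_atTop_nhds_zero_nat
    simpa using this.const_mul t
  have h1 : Tendsto (fun k => t • y (φ k)) atTop (𝓝 (t • z)) := hlim.const_smul t
  have h2 : Tendsto (fun k => (fun _ : ι => t * ((φ k : ℕ) + 1 : ℝ≥0)⁻¹) ⊔ q (y (φ k))) atTop
      (𝓝 (0 ⊔ q z)) :=
    (tendsto_pi_nhds.2 fun _ => h0.comp hφ.tendsto_atTop).sup_nhds ((cont.tendsto z).comp hlim)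
  have := le_of_tendsto_of_tendsto' h1 h2 fun k => hy (φ k)
  simpa using this

/-- Nonlinear Perron-Frobenius: a monotone, homogeneous and continuous self-map of the standard
cone has a largest eigenvalue, which is also its largest sub-eigenvalue. -/
theorem exists_isGreatest_eigenvalue (mono : Monotone q)
    (hom : ∀ (c : ℝ≥0) x, q (c • x) = c • q x) (cont : Continuous q) :
    ∃ r, (∃ x, x ≠ 0 ∧ q x = r • x) ∧ IsGreatest {t : ℝ≥0 | ∃ x, x ≠ 0 ∧ t • x ≤ q x} r := by
  obtain ⟨r, hr⟩ := exists_isGreatest_subeigenvalue mono hom cont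
  refine ⟨r, ?_, hr⟩
  set t : ℕ → ℝ≥0 := fun k => r + 1 / (k + 1) with ht
  have hlt : ∀ k, r < t k := fun k => by
    simp only [ht]
    exact lt_add_of_pos_right _ (by positivity)
  have htpos : ∀ k, 0 < t k := fun k => zero_le.trans_lt (hlt k)
  have htr : Tendsto t atTop (𝓝 r) := by
    have : Tendsto (fun N : ℕ => (1 : ℝ≥0) / (N + 1)) atTop (𝓝 0) :=
      tendsto_one_div_add_atTop_nhds_zero_nat
    simpa [ht] using this.const_add r
  -- Resolvent solutions for `t k ↓ r`, normalized; `p.1` is what the constant `1` becomes, and it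
  -- stays a lower bound for `p.2`.
  have hy : ∀ k, ∃ p : ℝ≥0 × (ι → ℝ≥0), p ∈ Set.Icc (0 : ℝ≥0) 1 ×ˢ unitMax ι ∧
      (fun _ => t k * p.1) ⊔ q p.2 = t k • p.2 ∧ (fun _ => p.1) ≤ p.2 := by
    intro k
    obtain ⟨x, hx1, hx⟩ := exists_resolvent mono hom cont (htpos k) fun x h => by
      by_contra hne
      exact (hlt k).not_ge (hr.2 ⟨x, hne, h⟩)
    have hx0 : x ≠ 0 := fun h => by
      have := hx1 (Classical.arbitrary ι)
      simp [h] at this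
    obtain ⟨M, hM, hxM, hmem⟩ := exists_smul_mem_unitMax hx0
    refine ⟨(M⁻¹, M⁻¹ • x), ⟨⟨zero_le, ?_⟩, hmem⟩, ?_, fun i => ?_⟩
    · exact inv_le_one_of_one_le₀ ((hx1 (Classical.arbitrary ι)).trans (hxM _))
    · funext i
      have := congrFun hx i
      simp only [Pi.sup_apply, Pi.smul_apply, smul_eq_mul, Pi.one_apply, hom] at this ⊢
      rw [← this, ← mul_assoc, mul_max, mul_one, ← mul_assoc,
        mul_right_comm (t k) M⁻¹, mul_inv_cancel₀ (htpos k).ne', one_mul]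
    · simpa using mul_le_mul_right (hx1 i) M⁻¹
  choose p hpK hp hp1 using hy
  obtain ⟨⟨s, y⟩, hz, φ, hφ, hlim⟩ :=
    (isCompact_Icc.prod (isCompact_unitMax ι)).tendsto_subseq hpK
  have hs : Tendsto (fun k => (p (φ k)).1) atTop (𝓝 s) :=
    (continuous_fst.tendsto _).comp hlim
  have hyl : Tendsto (fun k => (p (φ k)).2) atTop (𝓝 y) :=
    (continuous_snd.tendsto _).comp hlim
  have htφ : Tendsto (fun k => t (φ k)) atTop (𝓝 r) := htr.comp hφ.tendsto_atTop
  have hsy : (fun _ => s) ≤ y :=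
    le_of_tendsto_of_tendsto' (tendsto_pi_nhds.2 fun _ => hs) hyl fun k => hp1 (φ k)
  have heq : (fun _ => r * s) ⊔ q y = r • y := by
    have h1 : Tendsto (fun k => (fun _ : ι => t (φ k) * (p (φ k)).1) ⊔ q (p (φ k)).2) atTop
        (𝓝 ((fun _ => r * s) ⊔ q y)) :=
      (tendsto_pi_nhds.2 fun _ => htφ.mul hs).sup_nhds ((cont.tendsto y).comp hyl)
    have h2 : Tendsto (fun k => t (φ k) • (p (φ k)).2) atTop (𝓝 (r • y)) := htφ.smul hyl
    refine tendsto_nhds_unique h1 (h2.congr fun k => (hp (φ k)).symm)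
  -- If the constant term dies in the limit, `y` is an eigenvector. Otherwise `y ≥ s > 0` everywhere
  -- and `r⁻¹ • q y ≤ y`, so a sub-eigenvector scaled below `y` has an increasing orbit bounded by
  -- `y`; its limit is an eigenvector.
  by_cases hrs : r * s = 0
  · refine ⟨y, ne_zero_of_mem_unitMax hz.2, ?_⟩
    rw [← heq, hrs]
    exact (sup_eq_right.2 fun i => zero_le).symm
  have hr0 : r ≠ 0 := left_ne_zero_of_mul hrs
  have hs0 : s ≠ 0 := right_ne_zero_of_mul hrs
  obtain ⟨u, hu0, hu⟩ := hr.1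
  obtain ⟨M, hM, huM, hmem⟩ := exists_smul_mem_unitMax hu0
  set F : (ι → ℝ≥0) → ι → ℝ≥0 := fun x => r⁻¹ • q x with hF
  have hFm : Monotone F := fun x y h i => mul_le_mul_right (mono h i) _
  set v := s • M⁻¹ • u with hv
  have hvy : v ≤ y := fun i => by
    refine le_trans ?_ (hsy i)
    exact mul_le_of_le_one_right zero_le (hmem.1 i)
  have hFy : F y ≤ y := fun i => by
    have : q y i ≤ r * y i := (le_sup_right : q y ≤ _).trans_eq heq i
    calc r⁻¹ * q y i ≤ r⁻¹ * (r * y i) := by gcongr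
      _ = y i := by field_simp
  have hvF : v ≤ F v := fun i => by
    have : r * u i ≤ q u i := hu i
    simp only [hF, hv, hom, Pi.smul_apply, smul_eq_mul]
    calc s * (M⁻¹ * u i) = r⁻¹ * (s * (M⁻¹ * (r * u i))) := by field_simp
      _ ≤ _ := by gcongr
  obtain ⟨x, hvx, hx⟩ := exists_fixedPoint_of_le hFm (cont.fun_const_smul r⁻¹) hvF (v := y) fun k => by
    induction k with
    | zero => exact hvy
    | succ k ih => rw [Function.iterate_succ_apply']; exact (hFm ih).trans hFy
  refine ⟨x, ?_, ?_⟩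
  · rintro rfl
    obtain ⟨i, hi⟩ := hmem.2
    have := hvx i
    rw [hv, Pi.smul_apply, hi] at this
    simp [hs0] at this
  · conv_rhs => rw [← hx]
    simp [hF, smul_smul, hr0]

end

/-! ### Transport to max-plus vectors by the exponential. -/

section

/-- The exponential, as an order isomorphism from `ℝ ∪ {-∞}` to the nonnegative reals. -/
noncomputable def expIso : Rmax ≃o ℝ≥0 where
  toFun a := WithBot.recBotCoe 0 (fun t : ℝ => Real.toNNReal (Real.exp t)) a
  invFun y := if y = 0 then ⊥ else ((Real.log y : ℝ) : Rmax)
  left_inv a := by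
    induction a using WithBot.recBotCoe with
    | bot => simp
    | coe t => simp [Real.exp_pos, (Real.exp_pos t).le]
  right_inv y := by
    by_cases hy : y = 0
    · simp [hy]
    · have : (0 : ℝ) < y := by positivity
      simp [hy, Real.exp_log this]
  map_rel_iff' {a b} := by
    induction a using WithBot.recBotCoe with
    | bot => simp
    | coe t =>
      induction b using WithBot.recBotCoe with
      | bot => simp [Real.exp_pos]
      | coe s => simp [Real.toNNReal_le_toNNReal_iff, (Real.exp_pos s).le]

theorem expIso_add (a b : Rmax) : expIso (a + b) = expIso a * expIso b := by
  induction a using WithBot.recBotCoe with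
  | bot => simp
  | coe t =>
    induction b using WithBot.recBotCoe with
    | bot => simp
    | coe s =>
      rw [← WithBot.coe_add]
      simp only [expIso, RelIso.coe_fn_mk, Equiv.coe_fn_mk, WithBot.recBotCoe_coe, Real.exp_add]
      exact Real.toNNReal_mul (Real.exp_pos t).le

theorem expIso_symm_mul (c d : ℝ≥0) : expIso.symm (c * d) = expIso.symm c + expIso.symm d := by
  apply expIso.injective
  simp [expIso_add]

theorem expIso_eq_zero {a : Rmax} : expIso a = 0 ↔ a = ⊥ := by
  rw [← map_eq_bot_iff expIso, bot_eq_zero]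

variable {ι κ μ : Type}

theorem bot_vadd (x : ι → Rmax) : (⊥ : Rmax) +ᵥ x = ⊥ := funext fun i => WithBot.bot_add (x i)

theorem vadd_mono (t : Rmax) {x y : ι → Rmax} (h : x ≤ y) : t +ᵥ x ≤ t +ᵥ y :=
  fun i => add_le_add_right (h i) t

theorem vadd_ne_bot {t : Rmax} (ht : t ≠ ⊥) {x : ι → Rmax} (hx : x ≠ ⊥) : t +ᵥ x ≠ ⊥ := by
  contrapose! hx
  funext i
  have := congrFun hx i
  exact (WithBot.add_eq_bot.1 this).resolve_left ht

/-- Monotone maps of max-plus vectors commuting with the addition of scalars and continuous for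
the topology of `ℝ ∪ {-∞}` (transported from the nonnegative reals by the exponential). -/
structure IsConical (q : (ι → Rmax) → κ → Rmax) : Prop where
  mono : Monotone q
  hom : ∀ (t : Rmax) x, q (t +ᵥ x) = t +ᵥ q x
  cont : Continuous fun (y : ι → ℝ≥0) k => expIso (q (fun i => expIso.symm (y i)) k)

namespace IsConical

theorem map_bot {q : (ι → Rmax) → κ → Rmax} (hq : IsConical q) : q ⊥ = ⊥ := by
  rw [← bot_vadd ⊥, hq.hom, bot_vadd]

protected theorem id : IsConical fun x : ι → Rmax => x :=
  ⟨monotone_id, fun _ _ => rfl, by simpa using! continuous_id⟩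

theorem comp {p : (κ → Rmax) → μ → Rmax} {q : (ι → Rmax) → κ → Rmax}
    (hp : IsConical p) (hq : IsConical q) : IsConical fun x => p (q x) where
  mono := hp.mono.comp hq.mono
  hom t x := by rw [hq.hom, hp.hom]
  cont := by simpa [Function.comp_def] using hp.cont.comp hq.cont

protected theorem inf {p q : (ι → Rmax) → κ → Rmax} (hp : IsConical p) (hq : IsConical q) :
    IsConical fun x => p x ⊓ q x where
  mono := hp.mono.inf hq.mono
  hom t x := by
    rw [hp.hom, hq.hom]
    funext k
    exact min_add_add_left t _ _
  cont := by
    refine continuous_pi fun k => ?_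
    simp only [Pi.inf_apply, expIso.monotone.map_min]
    exact ((continuous_apply k).comp hp.cont).min ((continuous_apply k).comp hq.cont)

theorem reindex (σ : κ → ι) : IsConical fun (x : ι → Rmax) k => x (σ k) where
  mono _ _ h k := h (σ k)
  hom _ _ := rfl
  cont := by simpa using continuous_pi fun k => continuous_apply (σ k)

protected theorem mulVec [Fintype κ] (A : Matrix ι κ Rmax) : IsConical (mulVec A) where
  mono _ _ h _ := Finset.sup_mono_fun fun j _ => add_le_add_right (h j) _
  hom t x := by
    funext i
    change Finset.univ.sup (fun j => A i j + (t + x j)) = t + Finset.univ.sup fun j => A i j + x j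
    rw [Finset.apply_sup_eq_sup_comp_of_linearOrder (fun a : Rmax => t + a)
      (fun a b h => add_le_add_right h t) (WithBot.add_bot t)]
    congr 1
    funext j
    exact add_left_comm _ _ _
  cont := by
    refine continuous_pi fun i => ?_
    simp only [mulVec, map_finset_sup, Function.comp_def, expIso_add, OrderIso.apply_symm_apply]
    exact Continuous.finset_sup_apply fun j _ => continuous_const.mul (continuous_apply j)

end IsConical

/-- The scalars `t` for which `t + x ≤ q x` has a solution other than `-∞`. -/
def subeigenvalues (q : (ι → Rmax) → ι → Rmax) : Set Rmax := {t | ∃ x, x ≠ ⊥ ∧ t +ᵥ x ≤ q x}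

/-- For `t ≠ ⊥`, `q` carries a solution for `p ∘ q` to one for `q ∘ p`; its image is not `⊥`, since
`p` fixes `⊥`. -/
theorem subeigenvalues_comp_subset {p : (κ → Rmax) → ι → Rmax} {q : (ι → Rmax) → κ → Rmax}
    [Nonempty κ] (hp : IsConical p) (hq : IsConical q) :
    subeigenvalues (p ∘ q) ⊆ subeigenvalues (q ∘ p) := by
  rintro t ⟨x, hx, h⟩
  by_cases ht : t = ⊥
  · refine ⟨fun _ => 0, fun h => ?_, ?_⟩
    · exact WithBot.zero_ne_bot (congrFun h (Classical.arbitrary κ))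
    · rw [ht, bot_vadd]
      exact bot_le
  refine ⟨q x, fun hqx => ?_, ?_⟩
  · rw [Function.comp_apply, hqx, hp.map_bot] at h
    exact vadd_ne_bot ht hx (le_bot_iff.1 h)
  · rw [← hq.hom]
    exact hq.mono h

theorem mulVec_ne_bot [Fintype κ] {C : Matrix ι κ Rmax} (hC : ∀ j, ∃ i, C i j ≠ ⊥) {x : κ → Rmax} (hx : x ≠ ⊥) : mulVec C x ≠ ⊥ := by
  contrapose! hx
  funext j
  obtain ⟨i, hi⟩ := hC j
  have h1 : C i j + x j ≤ ⊥ := by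
    rw [show (⊥ : Rmax) = mulVec C x i by rw [hx]; rfl]
    exact Finset.le_sup (f := fun j => C i j + x j) (Finset.mem_univ j)
  exact (WithBot.add_eq_bot.1 (le_bot_iff.1 h1)).resolve_left hi

/-! ### Residuation and projectors. -/

variable [Fintype ι] {C : Matrix ι κ Rmax}

open Classical in
/-- The residuated operator of a matrix without `-∞` column. -/
noncomputable def residual (hC : ∀ j, ∃ i, C i j ≠ ⊥) (y : ι → Rmax) : κ → Rmax := fun j =>
  (Finset.univ.filter fun i => C i j ≠ ⊥).inf' (by simpa [Finset.Nonempty] using hC j)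
    fun i => ((-(C i j).unbotD 0 : ℝ) : Rmax) + y i

theorem residual_isConical (hC : ∀ j, ∃ i, C i j ≠ ⊥) : IsConical (residual hC) where
  mono _ _ h _ := Finset.inf'_mono_fun fun i _ => add_le_add_right (h i) _
  hom t x := by
    funext j
    simp only [residual, Pi.vadd_apply, vadd_eq_add]
    rw [Finset.apply_inf'_eq_inf'_comp _ (fun a : Rmax => t + a)
      (fun a b => (min_add_add_left t a b).symm)]
    congr 1
    funext i
    exact add_left_comm _ _ _
  cont := by
    refine continuous_pi fun j => ?_
    simp only [residual, map_finset_inf', Function.comp_def, expIso_add,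
      OrderIso.apply_symm_apply]
    exact Continuous.finset_inf'_apply _ fun i _ => continuous_const.mul (continuous_apply i)

@[simp] theorem ext_bot : ext ⊥ = ⊥ := rfl

@[simp] theorem ext_coe (t : ℝ) : ext (t : Rmax) = (t : EReal) := rfl

theorem ext_strictMono : StrictMono ext := by
  intro a b h
  induction b using WithBot.recBotCoe with
  | bot => simp at h
  | coe b =>
    induction a using WithBot.recBotCoe with
    | bot => simp
    | coe a => simpa using h

theorem ext_injective : Function.Injective ext := ext_strictMono.injective

theorem resid_eq {a : Rmax} (ha : a ≠ ⊥) (y : Rmax) :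
    resid a y = ext (((-a.unbotD 0 : ℝ) : Rmax) + y) := by
  lift a to ℝ using ha
  induction y using WithBot.recBotCoe with
  | bot => simp [resid]
  | coe y =>
    rw [← WithBot.coe_add]
    simp only [resid, WithBot.coe_ne_bot, if_false, ext_coe, WithBot.unbotD_coe, EReal.coe_add,
      EReal.coe_neg]
    rw [sub_eq_add_neg, add_comm]

/-- Entries `⊥` contribute `⊤` to the infimum and can be dropped; at least one entry remains in each
column, so the value `⊤` never occurs. -/
theorem sharp_eq_residual (hC : ∀ j, ∃ i, C i j ≠ ⊥) (y : ι → Rmax) (j : κ) : sharp C y j = ext (residual hC y j) := by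
  refine eq_of_forall_le_iff fun c => ?_
  rw [residual, Finset.apply_inf'_eq_inf'_comp _ ext fun a b => ext_strictMono.monotone.map_min,
    Finset.le_inf'_iff, sharp,
    Finset.le_inf_iff]
  refine forall_congr' fun i => ?_
  by_cases hij : C i j = ⊥
  · simp [hij, resid]
  · simp [hij, resid_eq hij]

variable [Fintype κ]

theorem le_residual_iff (hC : ∀ j, ∃ i, C i j ≠ ⊥) {x : κ → Rmax} {y : ι → Rmax} :
    x ≤ residual hC y ↔ mulVec C x ≤ y := by
  have key : ∀ (a : Rmax), a ≠ ⊥ → ∀ u v : Rmax,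
      u ≤ ((-a.unbotD 0 : ℝ) : Rmax) + v ↔ a + u ≤ v := by
    intro a ha u v
    lift a to ℝ using ha
    induction u using WithBot.recBotCoe with
    | bot => simp
    | coe u =>
      induction v using WithBot.recBotCoe with
      | bot => simp [← WithBot.coe_add]
      | coe v =>
        rw [← WithBot.coe_add, ← WithBot.coe_add, WithBot.coe_le_coe, WithBot.coe_le_coe,
          WithBot.unbotD_coe]
        constructor <;> intro h <;> linarith
  constructor
  · intro h i
    refine Finset.sup_le fun j _ => ?_
    by_cases hij : C i j = ⊥
    · simp [hij]
    · refine (key _ hij _ _).1 ((h j).trans ?_)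
      exact Finset.inf'_le (fun i => ((-(C i j).unbotD 0 : ℝ) : Rmax) + y i) (by simpa using hij)
  · intro h j
    refine Finset.le_inf' _ _ fun i hi => (key _ (by simpa using hi) _ _).2 ?_
    exact (Finset.le_sup (f := fun j => C i j + x j) (Finset.mem_univ j)).trans (h i)

/-- By the adjunction `le_residual_iff`, the supremum is attained at the largest `x` with `C x ≤ z`.
-/
theorem proj_eq (hC : ∀ j, ∃ i, C i j ≠ ⊥) (z : ι → Rmax) : proj C z = mulVec C (residual hC z) := by
  refine IsGreatest.csSup_eq ⟨⟨⟨_, rfl⟩, (le_residual_iff hC).1 le_rfl⟩, ?_⟩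
  rintro _ ⟨⟨x, rfl⟩, hx⟩
  exact (IsConical.mulVec C).mono ((le_residual_iff hC).2 hx)

theorem proj_isConical (hC : ∀ j, ∃ i, C i j ≠ ⊥) : IsConical (proj C) := by
  rw [funext (proj_eq hC)]
  exact (IsConical.mulVec C).comp (residual_isConical hC)

theorem proj_le (hC : ∀ j, ∃ i, C i j ≠ ⊥) (z : ι → Rmax) : proj C z ≤ z := by
  rw [proj_eq hC]
  exact (le_residual_iff hC).1 le_rfl

theorem mulVec_le_proj (hC : ∀ j, ∃ i, C i j ≠ ⊥) {x : κ → Rmax} {z : ι → Rmax} (h : mulVec C x ≤ z) :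
    mulVec C x ≤ proj C z := by
  rw [proj_eq hC]
  exact (IsConical.mulVec C).mono ((le_residual_iff hC).2 h)

theorem IsConical.exists_isGreatest_eigenvalue [Nonempty ι] {q : (ι → Rmax) → ι → Rmax}
    (hq : IsConical q) :
    ∃ r, (∃ x, x ≠ ⊥ ∧ q x = r +ᵥ x) ∧ IsGreatest (subeigenvalues q) r := by
  set Q : (ι → ℝ≥0) → ι → ℝ≥0 := fun y k => expIso (q (fun i => expIso.symm (y i)) k) with hQ
  have hom : ∀ (c : ℝ≥0) y, Q (c • y) = c • Q y := by
    intro c y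
    funext k
    have := congrFun (hq.hom (expIso.symm c) fun i => expIso.symm (y i)) k
    simp only [hQ, Pi.smul_apply, smul_eq_mul, expIso_symm_mul]
    calc _ = expIso (q (expIso.symm c +ᵥ fun i => expIso.symm (y i)) k) := rfl
      _ = _ := by rw [this, Pi.vadd_apply, vadd_eq_add, expIso_add, OrderIso.apply_symm_apply]
  have mono : Monotone Q := fun x y h k =>
    expIso.monotone (hq.mono (fun i => expIso.symm.monotone (h i)) k)
  obtain ⟨r, ⟨y, hy, hyr⟩, -, hub⟩ := MaxPlus.exists_isGreatest_eigenvalue mono hom hq.cont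
  have heig : ∃ x, x ≠ ⊥ ∧ q x = expIso.symm r +ᵥ x := by
    refine ⟨fun i => expIso.symm (y i), fun h => hy ?_, ?_⟩
    · funext i
      have := congrFun h i
      simpa using this
    · funext k
      apply expIso.injective
      rw [Pi.vadd_apply, vadd_eq_add, expIso_add]
      simpa using congrFun hyr k
  refine ⟨_, heig, ?_, ?_⟩
  · obtain ⟨x, hx, h⟩ := heig
    exact ⟨x, hx, h.ge⟩
  · rintro t ⟨x, hx, h⟩
    rw [← OrderIso.symm_apply_apply expIso t]
    apply expIso.symm.monotone
    refine hub ⟨fun i => expIso (x i), fun h => hx ?_, fun i => ?_⟩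
    · funext i
      exact expIso_eq_zero.1 (congrFun h i)
    · have := expIso.monotone (h i)
      rw [Pi.vadd_apply, vadd_eq_add, expIso_add] at this
      simpa [hQ] using this

/-- This reduces the computation of a spectral radius to that of a set of sub-eigenvalues. -/
theorem IsConical.isSpectralRadius {q : (ι → Rmax) → ι → Rmax} (hq : IsConical q)
    {r : Rmax} (hr : IsGreatest (subeigenvalues q) r) : IsSpectralRadius (extMap q) r := by
  have : Nonempty ι := by
    obtain ⟨x, hx, -⟩ := hr.1
    exact (Function.ne_iff.1 hx).nonempty
  obtain ⟨s, ⟨x, hx, h⟩, hs⟩ := hq.exists_isGreatest_eigenvalue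
  obtain rfl := hs.unique hr
  refine ⟨⟨x, hx, fun i => congrArg ext (congrFun h i)⟩, ?_⟩
  rintro t ⟨y, hy, hty⟩
  exact hr.2 ⟨y, hy, fun i => (ext_injective (hty i)).ge⟩

end

/-! ### Sub-eigenvalues of the five maps, and the distance. -/

section

variable {ι κ : Type}

@[simp] theorem mulVec_fromRows [Fintype κ] (A B : Matrix ι κ Rmax) (x : κ → Rmax) :
    mulVec (Matrix.fromRows A B) x = Sum.elim (mulVec A x) (mulVec B x) := by
  funext i
  rcases i with i | i <;> rfl

theorem mulVec_idMatrix [Fintype ι] [DecidableEq ι] (x : ι → Rmax) :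
    mulVec (idMatrix ι) x = x := by
  funext i
  refine le_antisymm (Finset.sup_le fun j _ => ?_) ?_
  · by_cases h : i = j <;> simp [idMatrix, h]
  · exact le_of_eq_of_le (by simp [idMatrix])
      (Finset.le_sup (f := fun j => idMatrix ι i j + x j) (Finset.mem_univ i))

theorem sumElim_le_sumElim {a b c d : ι → Rmax} :
    Sum.elim a b ≤ Sum.elim c d ↔ a ≤ c ∧ b ≤ d := by
  simp [Pi.le_def]

theorem vadd_sumElim (t : Rmax) (a b : ι → Rmax) :
    t +ᵥ Sum.elim a b = Sum.elim (t +ᵥ a) (t +ᵥ b) := by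
  funext i
  rcases i with i | i <;> rfl

/-- Chaining the inequalities gives `2t + a ≤ a`; if `t` is finite, one finite entry makes the other
finite. -/
theorem nonpos_of_add_le {t a b : Rmax} (h : t + a ≤ b) (h' : t + b ≤ a) (hab : a ≠ ⊥ ∨ b ≠ ⊥) :
    t ≤ 0 := by
  induction t using WithBot.recBotCoe with
  | bot => exact bot_le
  | coe t =>
    induction a using WithBot.recBotCoe with
    | bot =>
      have := (WithBot.add_eq_bot.1 (le_bot_iff.1 h')).resolve_left WithBot.coe_ne_bot
      simp [this] at hab
    | coe a =>
      induction b using WithBot.recBotCoe with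
      | bot =>
        have := (WithBot.add_eq_bot.1 (le_bot_iff.1 h)).resolve_left WithBot.coe_ne_bot
        exact absurd this WithBot.coe_ne_bot
      | coe b =>
        rw [← WithBot.coe_add, WithBot.coe_le_coe] at h h'
        rw [← WithBot.coe_zero, WithBot.coe_le_coe]
        linarith

theorem exists_fromRows_ne_bot {A B : Matrix ι κ Rmax}
    (hAB : ∀ j, ∃ i, A i j ≠ ⊥ ∨ B i j ≠ ⊥) (j : κ) :
    ∃ i, Matrix.fromRows A B i j ≠ ⊥ := by
  obtain ⟨i, h | h⟩ := hAB j
  · exact ⟨Sum.inl i, h⟩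
  · exact ⟨Sum.inr i, h⟩

theorem idMatrix_fromRows_ne_bot [DecidableEq ι] (j : ι) :
    ∃ i, Matrix.fromRows (idMatrix ι) (idMatrix ι) i j ≠ ⊥ :=
  ⟨Sum.inl j, by simp [idMatrix]⟩

theorem sharp_inf_sharp [Fintype ι] {A B : Matrix ι κ Rmax}
    (hC : ∀ j, ∃ i, Matrix.fromRows A B i j ≠ ⊥) (y z : ι → Rmax) (j : κ) :
    (sharp A y ⊓ sharp B z) j = ext (residual hC (Sum.elim y z) j) := by
  rw [← sharp_eq_residual]
  refine eq_of_forall_le_iff fun c => ?_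
  simp only [sharp, Pi.inf_apply, le_inf_iff, Finset.le_inf_iff, Finset.mem_univ, true_imp_iff,
    Sum.forall]
  rfl

/-- As `-s` is finite, the two inequalities also force equal supports, which rules out the value
`⊤`. -/
theorem chebDist_le_ofReal_iff {u v : ι → Rmax} {s : ℝ} (hs : 0 ≤ s) :
    chebDist u v ≤ ENNReal.ofReal s ↔
      ((-s : ℝ) : Rmax) +ᵥ u ≤ v ∧ ((-s : ℝ) : Rmax) +ᵥ v ≤ u := by
  have key : ∀ a b : Rmax, ((a ≠ ⊥ ↔ b ≠ ⊥) ∧ (b ≠ ⊥ → |a.unbotD 0 - b.unbotD 0| ≤ s)) ↔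
      ((-s : ℝ) : Rmax) + a ≤ b ∧ ((-s : ℝ) : Rmax) + b ≤ a := by
    intro a b
    induction a using WithBot.recBotCoe with
    | bot => induction b using WithBot.recBotCoe <;> simp [← WithBot.coe_add]
    | coe a =>
      induction b using WithBot.recBotCoe with
      | bot => simp [← WithBot.coe_add]
      | coe b =>
        simp only [← WithBot.coe_add, WithBot.coe_le_coe, WithBot.unbotD_coe, abs_le, ne_eq,
          WithBot.coe_ne_bot, not_false_eq_true, true_and, forall_const]
        constructor <;> rintro ⟨h1, h2⟩ <;> constructor <;> linarith
  have hsupp : supp u = supp v ↔ ∀ i, (u i ≠ ⊥ ↔ v i ≠ ⊥) := Set.ext_iff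
  simp only [Pi.le_def, Pi.vadd_apply, vadd_eq_add, ← forall_and, ← key]
  rw [forall_and, ← hsupp, chebDist]
  split_ifs with h
  · simp only [and_iff_right h, iSup_le_iff, ENNReal.ofReal_le_ofReal_iff hs]
    rfl
  · simp [h]

variable [Fintype κ]

/-- The scalars `t` for which `t + A x ≤ B x` and `t + B x ≤ A x` have a common solution other
than `-∞`. -/
def gapScalars (A B : Matrix ι κ Rmax) : Set Rmax :=
  {t | ∃ x, x ≠ ⊥ ∧ t +ᵥ mulVec A x ≤ mulVec B x ∧ t +ᵥ mulVec B x ≤ mulVec A x}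

variable {A B : Matrix ι κ Rmax}

theorem nonpos_of_gap (hAB : ∀ j, ∃ i, A i j ≠ ⊥ ∨ B i j ≠ ⊥) {t : Rmax} {x : κ → Rmax}
    (hx : x ≠ ⊥) (h : t +ᵥ mulVec A x ≤ mulVec B x) (h' : t +ᵥ mulVec B x ≤ mulVec A x) :
    t ≤ 0 := by
  obtain ⟨i, hi⟩ := Function.ne_iff.1 (mulVec_ne_bot (exists_fromRows_ne_bot hAB) hx)
  rw [mulVec_fromRows] at hi
  rcases i with i | i
  · exact nonpos_of_add_le (h i) (h' i) (Or.inl hi)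
  · exact nonpos_of_add_le (h i) (h' i) (Or.inr hi)

theorem vadd_le_of_nonpos {t : Rmax} (ht : t ≤ 0) (x : ι → Rmax) : t +ᵥ x ≤ x := fun i => by
  simpa using add_le_add_left ht (x i)

variable [Fintype ι]

/-- The map `x ↦ C♯ (B x, A x)` for `C` the matrix of rows `A`, `B`. -/
noncomputable def crossResidual (hC : ∀ j, ∃ i, Matrix.fromRows A B i j ≠ ⊥) (x : κ → Rmax) :
    κ → Rmax :=
  residual hC fun i => mulVec (Matrix.fromRows A B) x i.swap

variable (hC : ∀ j, ∃ i, Matrix.fromRows A B i j ≠ ⊥)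

theorem crossResidual_isConical : IsConical (crossResidual hC) :=
  (residual_isConical hC).comp ((IsConical.reindex Sum.swap).comp (IsConical.mulVec _))

theorem vadd_le_crossResidual_iff {t : Rmax} {x : κ → Rmax} :
    t +ᵥ x ≤ crossResidual hC x ↔
      t +ᵥ mulVec A x ≤ mulVec B x ∧ t +ᵥ mulVec B x ≤ mulVec A x := by
  rw [crossResidual, le_residual_iff, (IsConical.mulVec _).hom, mulVec_fromRows, vadd_sumElim,
    ← sumElim_le_sumElim]
  refine Eq.to_iff (congrArg _ ?_)
  funext i
  rcases i with i | i <;> rfl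

theorem funH_eq : funH A B = extMap (crossResidual hC) := by
  funext x j
  rw [funH, sharp_inf_sharp hC, extMap, crossResidual]
  congr 3
  funext i
  rcases i with i | i <;> simp

theorem funF_eq : funF A B = extMap fun x => x ⊓ crossResidual hC x := by
  funext x j
  have := congrFun (congrFun (funH_eq hC) x) j
  rw [funF, inf_assoc]
  exact (congrArg (ext (x j) ⊓ ·) this).trans (ext_strictMono.monotone.map_min).symm

theorem funG_eq : funG A B = extMap fun x =>
    residual hC (mulVec (Matrix.fromRows A B) x) ⊓ crossResidual hC x := by
  funext x j
  have h1 := congrFun (congrFun (funH_eq hC) x) j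
  have h2 := sharp_inf_sharp hC (mulVec A x) (mulVec B x) j
  rw [← mulVec_fromRows] at h2
  rw [funG, inf_assoc]
  exact (congrArg₂ (· ⊓ ·) h2 h1).trans (ext_strictMono.monotone.map_min).symm

theorem subeigenvalues_funH : subeigenvalues (crossResidual hC) = gapScalars A B := by
  simp only [subeigenvalues, gapScalars, vadd_le_crossResidual_iff]

theorem subeigenvalues_funF (hAB : ∀ j, ∃ i, A i j ≠ ⊥ ∨ B i j ≠ ⊥) :
    subeigenvalues (fun x => x ⊓ crossResidual hC x) = gapScalars A B := by
  simp only [subeigenvalues, gapScalars, le_inf_iff, vadd_le_crossResidual_iff]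
  ext t
  refine exists_congr fun x => and_congr_right fun hx => and_iff_right_of_imp fun h => ?_
  exact vadd_le_of_nonpos (nonpos_of_gap hAB hx h.1 h.2) x

theorem subeigenvalues_funG (hAB : ∀ j, ∃ i, A i j ≠ ⊥ ∨ B i j ≠ ⊥) :
    subeigenvalues (fun x => residual hC (mulVec (Matrix.fromRows A B) x) ⊓ crossResidual hC x) =
      gapScalars A B := by
  simp only [subeigenvalues, gapScalars, le_inf_iff, vadd_le_crossResidual_iff]
  ext t
  refine exists_congr fun x => and_congr_right fun hx => and_iff_right_of_imp fun h => ?_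
  rw [le_residual_iff]
  exact (IsConical.mulVec _).mono (vadd_le_of_nonpos (nonpos_of_gap hAB hx h.1 h.2) x)

/-- Vectors of `span D` have the form `(w, w)`, and `(w, w) ≤ C x` says that `w` lies below both `A
x` and `B x`. -/
theorem subeigenvalues_proj_comp_proj [DecidableEq ι] [Nonempty κ]
    (hAB : ∀ j, ∃ i, A i j ≠ ⊥ ∨ B i j ≠ ⊥) :
    subeigenvalues (proj (Matrix.fromRows A B) ∘
      proj (Matrix.fromRows (idMatrix ι) (idMatrix ι))) = gapScalars A B := by
  have hC := exists_fromRows_ne_bot hAB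
  have hD := idMatrix_fromRows_ne_bot (ι := ι)
  ext t
  constructor
  · rintro ⟨y, hy, h⟩
    by_cases ht : t = ⊥
    · refine ⟨fun _ => 0, fun h => ?_, ?_⟩
      · exact WithBot.zero_ne_bot (congrFun h (Classical.arbitrary κ))
      · simp [ht, bot_vadd]
    set x := residual hC (proj (Matrix.fromRows (idMatrix ι) (idMatrix ι)) y)
    have hz : (proj (Matrix.fromRows A B) ∘
      proj (Matrix.fromRows (idMatrix ι) (idMatrix ι))) y = mulVec (Matrix.fromRows A B) x :=
      proj_eq hC _
    have hPm := (proj_isConical hC).mono.comp (proj_isConical hD).mono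
    have hPh := (proj_isConical hC).comp (proj_isConical hD)
    -- Applying the monotone `P_C P_D` to `h` replaces `y` by its image `C x`, which lies in `span
    -- C`.
    have h2 : t +ᵥ mulVec (Matrix.fromRows A B) x ≤
        proj (Matrix.fromRows (idMatrix ι) (idMatrix ι)) (mulVec (Matrix.fromRows A B) x) := by
      refine le_trans ?_ (proj_le hC _)
      have := hPm h
      rw [Function.comp_apply, hPh.hom] at this
      rwa [← hz]
    have h3 := proj_le hD (mulVec (Matrix.fromRows A B) x)
    rw [proj_eq hD] at h2 h3
    generalize residual hD _ = w at h2 h3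
    rw [mulVec_fromRows (idMatrix ι), mulVec_idMatrix] at h2 h3
    rw [mulVec_fromRows, vadd_sumElim, sumElim_le_sumElim] at h2
    rw [mulVec_fromRows, sumElim_le_sumElim] at h3
    refine ⟨x, fun hx => ?_, h2.1.trans h3.2, h2.2.trans h3.1⟩
    rw [hz, hx, (IsConical.mulVec _).map_bot] at h
    exact vadd_ne_bot ht hy (le_bot_iff.1 h)
  · rintro ⟨x, hx, h1, h2⟩
    have ht := nonpos_of_gap hAB hx h1 h2
    refine ⟨mulVec (Matrix.fromRows A B) x, mulVec_ne_bot hC hx, ?_⟩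
    rw [← (IsConical.mulVec _).hom]
    refine mulVec_le_proj hC ?_
    -- Then `t + C x ≤ (w, w) ≤ C x`, so `(w, w)` is an element of `span D` witnessing `t + C x ≤
    -- P_D (C x)`.
    set w := t +ᵥ (mulVec A x ⊔ mulVec B x)
    have hwA : w ≤ mulVec A x := by
      intro i
      change t + max (mulVec A x i) (mulVec B x i) ≤ _
      rw [← max_add_add_left]
      exact max_le (vadd_le_of_nonpos ht _ i) (h2 i)
    have hwB : w ≤ mulVec B x := by
      intro i
      change t + max (mulVec A x i) (mulVec B x i) ≤ _
      rw [← max_add_add_left]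
      exact max_le (h1 i) (vadd_le_of_nonpos ht _ i)
    refine le_trans ?_ (mulVec_le_proj hD (x := w) ?_)
    · rw [(IsConical.mulVec _).hom, mulVec_fromRows, mulVec_fromRows, mulVec_idMatrix,
        vadd_sumElim, sumElim_le_sumElim]
      exact ⟨vadd_mono t le_sup_left, vadd_mono t le_sup_right⟩
    · rw [mulVec_fromRows, mulVec_fromRows, mulVec_idMatrix, sumElim_le_sumElim]
      exact ⟨hwA, hwB⟩

omit [Fintype ι] in
theorem isLeast_chebDist (hAB : ∀ j, ∃ i, A i j ≠ ⊥ ∨ B i j ≠ ⊥) {r : Rmax}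
    (hr : IsGreatest (gapScalars A B) r) :
    ∃ d : ℝ≥0∞, IsLeast {e : ℝ≥0∞ | ∃ x : κ → Rmax, x ≠ ⊥ ∧
      e = chebDist (mulVec A x) (mulVec B x)} d ∧ ext r = -(d : EReal) := by
  obtain ⟨x, hx, hAx, hBx⟩ := hr.1
  have hr0 := nonpos_of_gap hAB hx hAx hBx
  -- Minus a finite distance is itself a gap scalar. If `r = ⊥`, every distance is therefore
  -- infinite.
  have hle : ∀ x : κ → Rmax, x ≠ ⊥ → chebDist (mulVec A x) (mulVec B x) ≠ ⊤ →
      ((-(chebDist (mulVec A x) (mulVec B x)).toReal : ℝ) : Rmax) ≤ r := fun x hx h =>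
    hr.2 ⟨x, hx, (chebDist_le_ofReal_iff ENNReal.toReal_nonneg).1 (ENNReal.ofReal_toReal h).ge⟩
  induction r using WithBot.recBotCoe with
  | bot =>
    have htop : ∀ x : κ → Rmax, x ≠ ⊥ → chebDist (mulVec A x) (mulVec B x) = ⊤ := fun x hx => by
      by_contra h
      exact absurd (hle x hx h) (by simp)
    refine ⟨⊤, ⟨⟨x, hx, (htop x hx).symm⟩, ?_⟩, by simp⟩
    rintro _ ⟨y, hy, rfl⟩
    exact (htop y hy).ge
  | coe r =>
    have hr1 : 0 ≤ -r := by
      rw [← WithBot.coe_zero, WithBot.coe_le_coe] at hr0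
      linarith
    have hlb : ∀ y : κ → Rmax, y ≠ ⊥ →
        ENNReal.ofReal (-r) ≤ chebDist (mulVec A y) (mulVec B y) := fun y hy => by
      by_cases h : chebDist (mulVec A y) (mulVec B y) = ⊤
      · simp [h]
      · have := WithBot.coe_le_coe.1 (hle y hy h)
        exact ENNReal.ofReal_le_of_le_toReal (by linarith)
    refine ⟨ENNReal.ofReal (-r), ⟨⟨x, hx, (hlb x hx).antisymm ?_⟩, ?_⟩, ?_⟩
    · exact (chebDist_le_ofReal_iff hr1).2 (by simpa using ⟨hAx, hBx⟩)
    · rintro _ ⟨y, hy, rfl⟩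
      exact hlb y hy
    · rw [EReal.coe_ennreal_ofReal, max_eq_left hr1]
      simp

end

end MaxPlus

theorem theorem4 (m n : ℕ) (hn : 0 < n) (A B : Matrix (Fin m) (Fin n) MaxPlus.Rmax)
    (hAB : ∀ j, ∃ i, A i j ≠ ⊥ ∨ B i j ≠ ⊥)
    (C : Matrix (Fin m ⊕ Fin m) (Fin n) MaxPlus.Rmax)
    (hC : C = Matrix.fromRows A B)
    (D : Matrix (Fin m ⊕ Fin m) (Fin m) MaxPlus.Rmax)
    (hD : D = Matrix.fromRows (MaxPlus.idMatrix (Fin m)) (MaxPlus.idMatrix (Fin m))) :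
    ∃ (r : MaxPlus.Rmax) (d : ENNReal),
      MaxPlus.IsSpectralRadius (MaxPlus.extMap (MaxPlus.proj C ∘ MaxPlus.proj D)) r ∧
      MaxPlus.IsSpectralRadius (MaxPlus.extMap (MaxPlus.proj D ∘ MaxPlus.proj C)) r ∧
      MaxPlus.IsSpectralRadius (MaxPlus.funF A B) r ∧
      MaxPlus.IsSpectralRadius (MaxPlus.funG A B) r ∧
      MaxPlus.IsSpectralRadius (MaxPlus.funH A B) r ∧
      IsLeast {e : ENNReal | ∃ x : Fin n → MaxPlus.Rmax, x ≠ ⊥ ∧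
        e = MaxPlus.chebDist (MaxPlus.mulVec A x) (MaxPlus.mulVec B x)} d ∧
      MaxPlus.ext r = -(d : EReal) := by
  subst hC hD
  have : Nonempty (Fin n) := ⟨⟨0, hn⟩⟩
  have : Nonempty (Fin m) := ⟨(hAB ⟨0, hn⟩).choose⟩
  have hC := MaxPlus.exists_fromRows_ne_bot hAB
  have hP := MaxPlus.proj_isConical hC
  have hQ := MaxPlus.proj_isConical (MaxPlus.idMatrix_fromRows_ne_bot (ι := Fin m))
  have hH := MaxPlus.crossResidual_isConical hC
  -- Existence is needed for one map only; the others have the same sub-eigenvalues.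
  obtain ⟨r, -, hr⟩ := hH.exists_isGreatest_eigenvalue
  rw [MaxPlus.subeigenvalues_funH] at hr
  obtain ⟨d, hd, hrd⟩ := MaxPlus.isLeast_chebDist hAB hr
  have hPQ := MaxPlus.subeigenvalues_proj_comp_proj hAB
  have hQP := (MaxPlus.subeigenvalues_comp_subset hQ hP).antisymm
    (MaxPlus.subeigenvalues_comp_subset hP hQ)
  refine ⟨r, d, (hP.comp hQ).isSpectralRadius (hPQ ▸ hr),
    (hQ.comp hP).isSpectralRadius (hQP.trans hPQ ▸ hr), ?_, ?_, ?_, hd, hrd⟩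
  · rw [MaxPlus.funF_eq hC]
    exact (MaxPlus.IsConical.id.inf hH).isSpectralRadius
      (MaxPlus.subeigenvalues_funF hC hAB ▸ hr)
  · rw [MaxPlus.funG_eq hC]
    exact (((MaxPlus.residual_isConical hC).comp (MaxPlus.IsConical.mulVec _)).inf
      hH).isSpectralRadius (MaxPlus.subeigenvalues_funG hC hAB ▸ hr)
  · rw [MaxPlus.funH_eq hC]
    exact hH.isSpectralRadius (MaxPlus.subeigenvalues_funH hC ▸ hr)
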